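/- For $0\le k\le n$ write $\binom{[n]}{k}$ for the family of $k$-element subsets of $[n]=\{1,\dots,n\}$, and for $\mathcal F\subset\binom{[n]}{k}$ write $\mu(\mathcal F)=|\mathcal F|/\binom nk$. For $\mathcal F\subset\binom{[n]}{k}$ and an integer $0\le r\le n-k$, the $r$-fold iterated upper shadow of $\mathcal F$ is $$\partial^{+r}(\mathcal F)=\Big\{B\in\tbinom{[n]}{k+r}:\ B\supset A\text{ for some }A\in\mathcal F\Big\}.$$ There exist absolute constants $C>0$ and $c>0$ such that the following holds. Let $\epsilon\in(0,1)$, let $n$ be even, let $\mathcal A\subset\binom{[n]}{n/2}$ with $\mathcal A\ne\emptyset$ and $\mathcal A\ne\binom{[n]}{n/2}$, and let $\mathcal A^c=\binom{[n]}{n/2}\setminus\mathcal A$. Suppose that $$n\ \ge\ \frac{C}{\epsilon^2}\left(\log\frac1\epsilon+\log\frac{1}{\mu(\mathcal A)(1-\mu(\mathcal A))}\right).$$ Then, for $r=\lceil\epsilon\sqrt n\,\rceil$, $$\mu\big(\partial^{+r}(\mathcal A)\cap\partial^{+r}(\mathcal A^c)\big)\ \ge\ c\,\frac{\epsilon^2}{\log\left(\frac{1}{\epsilon\,\mu(\mathcal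 A)(1-\mu(\mathcal A))}\right)}\;\mu(\mathcal A)(1-\mu(\mathcal A)).$$ -/

import Mathlib

/-- The `k`th layer of the `n`-cube: all `k`-element subsets of an `n`-element set. -/
def cubeLayer (n k : ℕ) : Finset (Finset (Fin n)) :=
  Finset.powersetCard k Finset.univ

/-- The uniform measure `|F| / (n choose k)` of a family `F` contained in the `k`th layer of
the `n`-cube. -/
noncomputable def layerMeasure (n k : ℕ) (F : Finset (Finset (Fin n))) : ℝ :=
  (F.card : ℝ) / (n.choose k : ℝ)

/-! Let U and U' be the upper shadows of the family A and of its complement in the layer. They cover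
layer j + r. If B ∈ U \ U' and T ∈ U' \ U met in j points, a j-subset of B ∩ T would lie in A or in
its complement, forcing T ∈ U or B ∈ U'; so |T \ B| > r. Thus D = U ∩ U' separates two families at
distance more than r. The distance to the first family, truncated at r, is 0 on it and r on the
second, so its variance is at least pq r², with p, q their measures. One swap changes it by at most
1, and only if an endpoint lies in D. The Poincaré inequality of the slice (`slice_poincare`)
therefore bounds μ(D) below by a multiple of pq r²/n. Local LYM gives μ(A) ≤ p + μ(D) and 1 - μ(A) ≤
q + μ(D), which turns pq into μ(A)(1 - μ(A)). With r² ≥ ε²n this yields the bound even without the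
logarithm. -/

open Finset

/-! ### Spectral gap of a slice -/

section Slice

variable {α : Type*} [DecidableEq α] [Fintype α]

/-- The up operator on functions on the cube: sum over all sets one level below. -/
def cubeUp (f : Finset α → ℝ) (S : Finset α) : ℝ := ∑ x ∈ S, f (S.erase x)

/-- The down operator on functions on the cube: sum over all sets one level above. -/
def cubeDown (f : Finset α → ℝ) (S : Finset α) : ℝ := ∑ x ∈ Sᶜ, f (insert x S)

theorem sum_sum_compl_eq_sum_sum_erase (F : α → Finset α → ℝ) :
    ∑ S : Finset α, ∑ x ∈ Sᶜ, F x S = ∑ T : Finset α, ∑ x ∈ T, F x (T.erase x) := by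
  rw [sum_sigma', sum_sigma']
  refine sum_bij' (fun p _ => ⟨insert p.2 p.1, p.2⟩) (fun p _ => ⟨p.1.erase p.2, p.2⟩)
    ?_ ?_ ?_ ?_ ?_
  all_goals rintro ⟨S, x⟩ h
  all_goals simp at h
  all_goals simp [h]

theorem sum_cubeDown_mul (f g : Finset α → ℝ) :
    ∑ S, cubeDown f S * g S = ∑ S, f S * cubeUp g S := by
  simp only [cubeDown, cubeUp, sum_mul, mul_sum]
  rw [sum_sum_compl_eq_sum_sum_erase fun x S => f (insert x S) * g S]
  refine sum_congr rfl fun T _ => sum_congr rfl fun x hx => ?_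
  rw [insert_erase hx]

/-- Both compositions sum f over all swaps of S; they differ only in the number of trivial moves,
|Sᶜ| against |S|. -/
theorem cubeDown_cubeUp (f : Finset α → ℝ) (S : Finset α) :
    cubeDown (cubeUp f) S =
      cubeUp (cubeDown f) S + ((Fintype.card α : ℝ) - 2 * #S) * f S := by
  have h1 : cubeDown (cubeUp f) S =
      ∑ x ∈ Sᶜ, (f S + ∑ y ∈ S, f ((insert x S).erase y)) := by
    refine sum_congr rfl fun x hx => ?_
    have hx' : x ∉ S := by simpa using hx
    rw [cubeUp, sum_insert hx', erase_insert hx']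
  have h2 : cubeUp (cubeDown f) S =
      ∑ y ∈ S, (f S + ∑ x ∈ Sᶜ, f ((insert x S).erase y)) := by
    refine sum_congr rfl fun y hy => ?_
    have hy' : y ∉ Sᶜ := by simpa using hy
    rw [cubeDown, compl_erase, sum_insert hy', insert_erase hy]
    congr 1
    refine sum_congr rfl fun x hx => ?_
    have hxy : x ≠ y := by
      rintro rfl
      exact hy' hx
    rw [erase_insert_of_ne hxy]
  rw [h1, h2, sum_add_distrib, sum_add_distrib, sum_comm]
  simp only [sum_const, nsmul_eq_mul]
  rw [card_compl, Nat.cast_sub (card_le_univ S)]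
  ring

theorem sum_cubeUp_sq {j : ℕ} {g : Finset α → ℝ} (hg : ∀ S, #S ≠ j → g S = 0) :
    ∑ S, cubeUp g S ^ 2 =
      ∑ S, cubeDown g S ^ 2 + ((Fintype.card α : ℝ) - 2 * j) * ∑ S, g S ^ 2 := by
  have h1 : ∑ S, cubeUp g S ^ 2 = ∑ S, cubeDown (cubeUp g) S * g S := by
    rw [sum_cubeDown_mul]
    simp only [sq]
  have h2 : ∑ S, cubeDown g S ^ 2 = ∑ S, cubeUp (cubeDown g) S * g S := by
    simp only [sq]
    rw [sum_cubeDown_mul]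
    exact sum_congr rfl fun S _ => mul_comm _ _
  rw [h1, h2, mul_sum, ← sum_add_distrib]
  refine sum_congr rfl fun S _ => ?_
  rw [cubeDown_cubeUp]
  by_cases hS : #S = j
  · rw [hS]
    ring
  · rw [hg S hS]
    ring

theorem cubeDown_eq_zero {k : ℕ} {f : Finset α → ℝ} (hf : ∀ S, #S ≠ k + 1 → f S = 0)
    (S : Finset α) (hS : #S ≠ k) : cubeDown f S = 0 := by
  refine sum_eq_zero fun x hx => hf _ ?_
  rw [card_insert_of_notMem (by simpa using hx)]
  omega

theorem sum_cubeDown {k : ℕ} {f : Finset α → ℝ} (hf : ∀ S, #S ≠ k → f S = 0) :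
    ∑ S, cubeDown f S = k * ∑ S, f S := by
  simp only [cubeDown]
  rw [sum_sum_compl_eq_sum_sum_erase fun x S => f (insert x S), mul_sum]
  refine sum_congr rfl fun T _ => ?_
  rw [sum_congr rfl fun x hx => by rw [insert_erase hx], sum_const, nsmul_eq_mul]
  by_cases hT : #T = k
  · rw [hT]
  · simp [hf T hT]

/-- The second largest eigenvalue of the up-down walk on the `k`th slice. -/
theorem sum_cubeDown_sq_le (k : ℕ) {f : Finset α → ℝ} (hf : ∀ S, #S ≠ k → f S = 0)
    (h0 : ∑ S, f S = 0) :
    ∑ S, cubeDown f S ^ 2 ≤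
      ((k : ℝ) - 1) * ((Fintype.card α : ℝ) - k) * ∑ S, f S ^ 2 := by
  induction k generalizing f with
  | zero =>
    have hz : ∀ S, f S = 0 := by
      intro S
      by_cases hS : #S = 0
      · rw [card_eq_zero] at hS
        rw [hS, ← h0]
        symm
        refine sum_eq_single ∅ (fun T _ hT => hf T (by simpa using hT)) (by simp)
      · exact hf S hS
    simp [hz, cubeDown]
  | succ k ih =>
    have hg := cubeDown_eq_zero hf
    have hg0 : ∑ S, cubeDown f S = 0 := by rw [sum_cubeDown hf, h0, mul_zero]
    have hD := ih hg hg0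
    have hU := sum_cubeUp_sq hg
    -- By adjointness ‖Df‖⁴ = ⟨f, UDf⟩² ≤ ‖f‖²‖UDf‖². Commutation and induction bound ‖UDf‖² by
    -- ((k-1)(n-k) + n-2k)‖Df‖² = k(n-k-1)‖Df‖², and one factor ‖Df‖² cancels.
    have hCS := sum_mul_sq_le_sq_mul_sq univ f (cubeUp (cubeDown f))
    rw [← sum_cubeDown_mul] at hCS
    simp only [← sq] at hCS
    set G := ∑ S, cubeDown f S ^ 2
    set F := ∑ S, f S ^ 2 with hFdef
    have hF : 0 ≤ F := sum_nonneg fun _ _ => sq_nonneg _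
    have hG : 0 ≤ G := sum_nonneg fun _ _ => sq_nonneg _
    have hUle : ∑ S, cubeUp (cubeDown f) S ^ 2 ≤ k * ((Fintype.card α : ℝ) - (k + 1)) * G := by
      rw [hU]
      linarith
    push_cast
    rcases hG.eq_or_lt with h | hpos
    · rw [← h]
      by_cases hk : k + 1 ≤ Fintype.card α
      · have : ((k : ℝ) + 1) ≤ Fintype.card α := by exact_mod_cast hk
        have h1 : 0 ≤ (Fintype.card α : ℝ) - (k + 1) := by linarith
        rw [add_sub_cancel_right]
        positivity
      · have : F = 0 := by
          refine sum_eq_zero fun S _ => ?_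
          rw [hf S (by have := card_le_univ S; omega)]
          simp
        rw [this, mul_zero]
    · refine le_of_mul_le_mul_right ?_ hpos
      calc G * G = G ^ 2 := (sq G).symm
        _ ≤ F * ∑ S, cubeUp (cubeDown f) S ^ 2 := hCS
        _ ≤ F * (k * ((Fintype.card α : ℝ) - (k + 1)) * G) := by gcongr
        _ = _ := by ring

/-- **Poincaré inequality** on the `k`th slice, for the walk which replaces one element. -/
theorem slice_poincare (k : ℕ) {f : Finset α → ℝ} (hf : ∀ S, #S ≠ k + 1 → f S = 0)
    (h0 : ∑ S, f S = 0) :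
    2 * Fintype.card α * ∑ S, f S ^ 2 ≤
      ∑ S with #S = k, ∑ x ∈ Sᶜ, ∑ y ∈ Sᶜ, (f (insert x S) - f (insert y S)) ^ 2 := by
  have hD := sum_cubeDown_sq_le (k + 1) hf h0
  have hinner : ∀ S : Finset α,
      ∑ x ∈ Sᶜ, ∑ y ∈ Sᶜ, (f (insert x S) - f (insert y S)) ^ 2 =
        2 * ((#Sᶜ : ℝ) * ∑ x ∈ Sᶜ, f (insert x S) ^ 2 - cubeDown f S ^ 2) := by
    intro S
    have : ∀ x ∈ Sᶜ, ∑ y ∈ Sᶜ, (f (insert x S) - f (insert y S)) ^ 2 =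
        #Sᶜ * f (insert x S) ^ 2 - 2 * f (insert x S) * cubeDown f S
          + ∑ y ∈ Sᶜ, f (insert y S) ^ 2 := by
      intro x _
      simp only [sub_sq, sum_add_distrib, sum_sub_distrib, sum_const, nsmul_eq_mul]
      rw [cubeDown, mul_sum]
    rw [sum_congr rfl this]
    simp only [sum_add_distrib, sum_sub_distrib, sum_const, nsmul_eq_mul, ← mul_sum, ← sum_mul]
    rw [← cubeDown]
    ring
  have hsq : ∑ S, cubeDown (fun T => f T ^ 2) S = (k + 1 : ℕ) * ∑ S, f S ^ 2 :=
    sum_cubeDown fun S hS => by rw [hf S hS]; simp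
  have hz : ∀ S : Finset α, #S ≠ k → ∀ x ∈ Sᶜ, f (insert x S) = 0 := by
    intro S hS x hx
    refine hf _ ?_
    rw [card_insert_of_notMem (by simpa using hx)]
    omega
  have hfull : ∑ S with #S = k, ∑ x ∈ Sᶜ, ∑ y ∈ Sᶜ, (f (insert x S) - f (insert y S)) ^ 2 =
      ∑ S, 2 * (((Fintype.card α : ℝ) - k) * cubeDown (fun T => f T ^ 2) S
        - cubeDown f S ^ 2) := by
    rw [sum_filter]
    refine sum_congr rfl fun S _ => ?_
    split_ifs with hS
    · rw [hinner, card_compl, Nat.cast_sub (card_le_univ S), hS]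
      rfl
    · rw [cubeDown, cubeDown, sum_eq_zero (hz S hS),
        sum_eq_zero fun x hx => by rw [hz S hS x hx]; simp]
      simp
  -- The gap is (n-k)(k+1) - k(n-k-1) = n.
  rw [hfull, ← mul_sum, sum_sub_distrib, ← mul_sum, hsq]
  push_cast at hD ⊢
  linarith

end Slice

/-! ### Separated families in a slice -/

section Separated

variable {α : Type*} [DecidableEq α]

/-- The number of elements of `T` outside the nearest member of `P`, truncated at `r`. -/
def truncDist (P : Finset (Finset α)) (r : ℕ) (T : Finset α) : ℕ :=
  P.fold min r fun B => #(T \ B)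

theorem truncDist_insert_le (P : Finset (Finset α)) (r : ℕ) (S : Finset α) (x y : α) :
    truncDist P r (insert x S) ≤ truncDist P r (insert y S) + 1 := by
  rw [truncDist, fold_min_le]
  rcases (fold_min_le (s := P) (b := r) (f := fun B => #(insert y S \ B)) _).1 le_rfl with h | h
  · exact Or.inl (h.trans (Nat.le_succ _))
  · obtain ⟨B, hB, h⟩ := h
    refine Or.inr ⟨B, hB, ?_⟩
    have h1 : insert x S \ B ⊆ insert x (insert y S \ B) := by
      intro z
      simp only [mem_sdiff, mem_insert]
      tauto
    exact (card_le_card h1).trans ((card_insert_le _ _).trans (Nat.succ_le_succ h))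

theorem truncDist_of_mem {P : Finset (Finset α)} {r : ℕ} {T : Finset α} (hT : T ∈ P) :
    truncDist P r T = 0 := by
  rw [← Nat.le_zero, truncDist, fold_min_le]
  exact Or.inr ⟨T, hT, by simp⟩

theorem truncDist_of_forall_le {P : Finset (Finset α)} {r : ℕ} {T : Finset α}
    (hT : ∀ B ∈ P, r ≤ #(T \ B)) : truncDist P r T = r := by
  refine le_antisymm ?_ ?_
  · rw [truncDist, fold_min_le]
    exact Or.inl le_rfl
  · rw [truncDist, le_fold_min]
    exact ⟨le_rfl, hT⟩

/-- Variance bound for masses p at 0 and q at r, about any centre t: the first inequality has defect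
(pt - q(r-t))². -/
theorem mul_mul_sq_le_of_separated_values {p q r t : ℝ} (hp : 0 ≤ p) (hq : 0 ≤ q) {M V : ℝ}
    (hM : p + q ≤ M) (hV : p * t ^ 2 + q * (r - t) ^ 2 ≤ V) : p * q * r ^ 2 ≤ M * V := by
  have hV0 : 0 ≤ V := le_trans (by positivity) hV
  calc p * q * r ^ 2 ≤ (p + q) * (p * t ^ 2 + q * (r - t) ^ 2) := by
        nlinarith [sq_nonneg (p * t - q * (r - t))]
    _ ≤ (p + q) * V := by gcongr
    _ ≤ M * V := by gcongr

variable [Fintype α]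

/-- Two families of a slice at distance more than `r` are separated by a large family. -/
theorem card_mul_card_le_of_separated {k r : ℕ} (hr : 1 ≤ r) {P Q D : Finset (Finset α)}
    (hPQ : Disjoint P Q) (hcover : P ∪ Q ∪ D = powersetCard (k + 1) univ)
    (hsep : ∀ B ∈ P, ∀ T ∈ Q, r < #(T \ B)) :
    (Fintype.card α : ℝ) * r ^ 2 * (#P * #Q) ≤
      ((Fintype.card α : ℝ) - k) * (k + 1) * #D * (Fintype.card α).choose (k + 1) := by
  set M := (Fintype.card α).choose (k + 1) with hMdef
  set L : Finset (Finset α) := powersetCard (k + 1) univ with hL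
  have hLcard : #L = M := by rw [hL, card_powersetCard, card_univ]
  have hmemL : ∀ S : Finset α, S ∈ L ↔ #S = k + 1 := by simp [hL, mem_powersetCard]
  have hPL : P ∪ Q ⊆ L := hcover ▸ subset_union_left
  rcases Nat.eq_zero_or_pos M with hM0 | hMpos
  · have : L = ∅ := card_eq_zero.1 (hLcard.trans hM0)
    have hP : P = ∅ := subset_empty.1 (this ▸ subset_union_left.trans hPL)
    simp [hP, hM0]
  set t : ℝ := (∑ S ∈ L, (truncDist P r S : ℝ)) / M with ht
  set f : Finset α → ℝ := fun S => if #S = k + 1 then (truncDist P r S : ℝ) - t else 0 with hf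
  have hfL : ∀ S ∈ L, f S = (truncDist P r S : ℝ) - t := fun S hS => by
    simp [hf, (hmemL S).1 hS]
  have hfz : ∀ S, #S ≠ k + 1 → f S = 0 := fun S hS => by simp [hf, hS]
  have hM' : (M : ℝ) ≠ 0 := by positivity
  have hf0 : ∑ S, f S = 0 := by
    rw [← sum_subset (subset_univ L) fun S _ hS => hfz S (mt (hmemL S).2 hS), sum_congr rfl hfL,
      sum_sub_distrib, sum_const, hLcard, nsmul_eq_mul, ht]
    field_simp
    ring
  have hfsq : (#P : ℝ) * t ^ 2 + #Q * ((r : ℝ) - t) ^ 2 ≤ ∑ S, f S ^ 2 := by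
    have hP : ∑ S ∈ P, f S ^ 2 = #P * t ^ 2 := by
      rw [sum_congr rfl fun S hS => by
        rw [hfL S (hPL (mem_union_left _ hS)), truncDist_of_mem hS], sum_const, nsmul_eq_mul]
      simp
    have hQ : ∑ S ∈ Q, f S ^ 2 = #Q * ((r : ℝ) - t) ^ 2 := by
      rw [sum_congr rfl fun S hS => by
        rw [hfL S (hPL (mem_union_right _ hS)),
          truncDist_of_forall_le fun B hB => (hsep B hB S hS).le], sum_const, nsmul_eq_mul]
    rw [← hP, ← hQ, ← sum_union hPQ]
    exact sum_le_sum_of_subset_of_nonneg (subset_univ _) fun _ _ _ => sq_nonneg _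
  have hvar := mul_mul_sq_le_of_separated_values (Nat.cast_nonneg _) (Nat.cast_nonneg _)
    (M := (M : ℝ)) (by
      rw [← hLcard, ← Nat.cast_add, ← card_union_of_disjoint hPQ]
      exact_mod_cast card_le_card hPL) hfsq
  set χ : Finset α → ℝ := fun S => if S ∈ D ∧ #S = k + 1 then 1 else 0 with hχ
  have hχ0 : ∀ S, 0 ≤ χ S := fun S => by simp only [hχ]; split_ifs <;> norm_num
  -- An edge missing D cannot join P to Q, since its ends differ by at most 1 ≤ r elements; so the
  -- distance is constant along it.
  have hedge : ∀ S : Finset α, #S = k → ∀ x ∈ Sᶜ, ∀ y ∈ Sᶜ,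
      (f (insert x S) - f (insert y S)) ^ 2 ≤ χ (insert x S) + χ (insert y S) := by
    intro S hS x hx y hy
    have hcx : #(insert x S) = k + 1 := by rw [card_insert_of_notMem (by simpa using hx), hS]
    have hcy : #(insert y S) = k + 1 := by rw [card_insert_of_notMem (by simpa using hy), hS]
    rw [hfL _ ((hmemL _).2 hcx), hfL _ ((hmemL _).2 hcy), sub_sub_sub_cancel_right]
    have hle : (((truncDist P r (insert x S) : ℕ) : ℝ) - truncDist P r (insert y S)) ^ 2 ≤ 1 := by
      have h1 : (truncDist P r (insert x S) : ℝ) ≤ truncDist P r (insert y S) + 1 := by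
        exact_mod_cast truncDist_insert_le P r S x y
      have h2 : (truncDist P r (insert y S) : ℝ) ≤ truncDist P r (insert x S) + 1 := by
        exact_mod_cast truncDist_insert_le P r S y x
      rw [sq_le_one_iff_abs_le_one, abs_le]
      constructor <;> linarith
    by_cases hxD : insert x S ∈ D
    · have : χ (insert x S) = 1 := by simp [hχ, hxD, hcx]
      linarith [hχ0 (insert y S)]
    by_cases hyD : insert y S ∈ D
    · have : χ (insert y S) = 1 := by simp [hχ, hyD, hcy]
      linarith [hχ0 (insert x S)]
    have hmem : ∀ z, #(insert z S) = k + 1 → insert z S ∉ D → insert z S ∈ P ∨ insert z S ∈ Q := by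
      intro z hz hzD
      have := (hmemL _).2 hz
      rw [← hcover] at this
      simpa [hzD] using this
    have hclose : ∀ u v : α, #(insert u S \ insert v S) ≤ r := by
      intro u v
      have : insert u S \ insert v S ⊆ {u} := by
        intro z
        simp only [mem_sdiff, mem_insert, mem_singleton]
        tauto
      exact (card_le_card this).trans (by simpa using hr)
    have heq : truncDist P r (insert x S) = truncDist P r (insert y S) := by
      rcases hmem x hcx hxD with hx' | hx' <;> rcases hmem y hcy hyD with hy' | hy'
      · rw [truncDist_of_mem hx', truncDist_of_mem hy']
      · exact absurd (hsep _ hx' _ hy') (hclose y x).not_gt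
      · exact absurd (hsep _ hy' _ hx') (hclose x y).not_gt
      · rw [truncDist_of_forall_le fun B hB => (hsep B hB _ hx').le,
          truncDist_of_forall_le fun B hB => (hsep B hB _ hy').le]
    rw [heq, sub_self]
    linarith [hχ0 (insert x S), hχ0 (insert y S), sq_nonneg (0 : ℝ)]
  have hχz : ∀ S, #S ≠ k + 1 → χ S = 0 := fun S hS => by simp [hχ, hS]
  have hχsum : ∑ S, χ S ≤ #D := by
    have : ∑ S, χ S ≤ ∑ S, if S ∈ D then (1 : ℝ) else 0 := by
      refine sum_le_sum fun S _ => ?_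
      simp only [hχ]
      by_cases h : S ∈ D <;> by_cases h' : #S = k + 1 <;> simp [h, h']
    simpa using this
  have hkn : (k : ℝ) ≤ Fintype.card α := by
    have : ¬ Fintype.card α < k + 1 := fun h => hMpos.ne' (Nat.choose_eq_zero_of_lt h)
    exact_mod_cast (by omega : k ≤ Fintype.card α)
  have hdir : ∑ S with #S = k, ∑ x ∈ Sᶜ, ∑ y ∈ Sᶜ, (f (insert x S) - f (insert y S)) ^ 2 ≤
      2 * (((Fintype.card α : ℝ) - k) * ((k + 1) * #D)) := by
    calc _ ≤ ∑ S : Finset α with #S = k, 2 * (((Fintype.card α : ℝ) - k) * cubeDown χ S) := by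
          refine sum_le_sum fun S hS => ?_
          have hS' : #S = k := by simpa using hS
          refine (sum_le_sum fun x hx => sum_le_sum fun y hy => hedge S hS' x hx y hy).trans
            (le_of_eq ?_)
          simp only [sum_add_distrib, sum_const, nsmul_eq_mul, ← mul_sum]
          rw [← cubeDown, card_compl, Nat.cast_sub (card_le_univ S), hS']
          ring
      _ = 2 * (((Fintype.card α : ℝ) - k) * ((k + 1) * ∑ S, χ S)) := by
          rw [← mul_sum, ← mul_sum, sum_subset (subset_univ _), sum_cubeDown hχz]
          · push_cast
            rfl
          · intro S _ hS
            exact cubeDown_eq_zero hχz S (by simpa using hS)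
      _ ≤ _ := by
          have : 0 ≤ (Fintype.card α : ℝ) - k := by linarith
          gcongr
  have hpoin := (slice_poincare k hfz hf0).trans hdir
  calc (Fintype.card α : ℝ) * r ^ 2 * (#P * #Q) = Fintype.card α * (#P * #Q * r ^ 2) := by ring
    _ ≤ Fintype.card α * (M * ∑ S, f S ^ 2) := by gcongr
    _ = M * (2 * Fintype.card α * ∑ S, f S ^ 2) / 2 := by ring
    _ ≤ M * (2 * (((Fintype.card α : ℝ) - k) * ((k + 1) * #D))) / 2 := by gcongr
    _ = _ := by ring

end Separated

/-! ### Shadows of a bipartition -/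

section Shadow

open scoped FinsetFamily

/-- Complementation turns upper shadows into lower ones, where local LYM applies. -/
theorem layerMeasure_le_layerMeasure_upShadow {n j : ℕ} (hj : j + 1 ≤ n)
    {A : Finset (Finset (Fin n))} (hA : (A : Set (Finset (Fin n))).Sized j) :
    layerMeasure n j A ≤ layerMeasure n (j + 1) (∂⁺ A) := by
  have hs : (Aᶜˢ : Set (Finset (Fin n))).Sized (n - j) := by
    intro S hS
    have := hA (mem_coe.2 (mem_compls.1 (mem_coe.1 hS)))
    rw [card_compl, Fintype.card_fin] at this
    have := card_le_univ S
    rw [Fintype.card_fin] at this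
    omega
  have h := local_lubell_yamamoto_meshalkin_inequality_div (𝕜 := ℝ) (by omega : n - j ≠ 0) hs
  rw [shadow_compls, card_compls, card_compls, Fintype.card_fin, Nat.choose_symm (by omega),
    (by omega : n - j - 1 = n - (j + 1)), Nat.choose_symm hj] at h
  exact h

theorem sized_upShadow_iterate {n j : ℕ} {A : Finset (Finset (Fin n))}
    (hA : (A : Set (Finset (Fin n))).Sized j) (r : ℕ) :
    ((∂⁺^[r] A : Finset (Finset (Fin n))) : Set (Finset (Fin n))).Sized (j + r) := by
  induction r with
  | zero => simpa using hA
  | succ r ih =>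
    rw [Function.iterate_succ_apply']
    exact ih.upShadow

theorem layerMeasure_le_layerMeasure_upShadow_iterate {n j : ℕ}
    {A : Finset (Finset (Fin n))} (hA : (A : Set (Finset (Fin n))).Sized j) {r : ℕ}
    (hr : j + r ≤ n) : layerMeasure n j A ≤ layerMeasure n (j + r) (∂⁺^[r] A) := by
  induction r with
  | zero => simp
  | succ r ih =>
    rw [Function.iterate_succ_apply']
    exact (ih (by omega)).trans
      (layerMeasure_le_layerMeasure_upShadow hr (sized_upShadow_iterate hA r))

theorem mem_cubeLayer {n k : ℕ} {S : Finset (Fin n)} : S ∈ cubeLayer n k ↔ #S = k := by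
  simp [cubeLayer]

/-- Isoperimetry for shadows of a bipartition of a layer. -/
theorem layerMeasure_upShadow_inter_lower_bound {n j r : ℕ} (hr : 1 ≤ r) (hjr : j + r ≤ n)
    {A : Finset (Finset (Fin n))} (hA : A ⊆ cubeLayer n j) :
    (n : ℝ) * r ^ 2 * (layerMeasure n j A * (1 - layerMeasure n j A)) ≤
      (n * r ^ 2 + ((n : ℝ) - (j + r - 1)) * (j + r)) *
        layerMeasure n (j + r) (∂⁺^[r] A ∩ ∂⁺^[r] (cubeLayer n j \ A)) := by
  set A' := cubeLayer n j \ A with hA'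
  set U := ∂⁺^[r] A with hU
  set U' := ∂⁺^[r] A' with hU'
  have hAs : (A : Set (Finset (Fin n))).Sized j := fun S hS => mem_cubeLayer.1 (hA hS)
  have hAs' : (A' : Set (Finset (Fin n))).Sized j :=
    fun S hS => mem_cubeLayer.1 (sdiff_subset (mem_coe.1 hS))
  have hcov : U \ U' ∪ U' \ U ∪ (U ∩ U') = powersetCard (j + r) univ := by
    have : U \ U' ∪ U' \ U ∪ (U ∩ U') = U ∪ U' := by
      ext S
      simp only [mem_union, mem_sdiff, mem_inter]
      tauto
    rw [this]
    ext S
    simp only [mem_union, mem_powersetCard, subset_univ, true_and]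
    constructor
    · rintro (h | h)
      · exact sized_upShadow_iterate hAs r h
      · exact sized_upShadow_iterate hAs' r h
    · intro hS
      obtain ⟨T, hTS, hT⟩ := exists_subset_card_eq (show j ≤ #S by omega)
      by_cases hTA : T ∈ A
      · exact Or.inl (mem_upShadow_iterate_iff_exists_mem_card_add.2 ⟨T, hTA, hTS, by omega⟩)
      · exact Or.inr (mem_upShadow_iterate_iff_exists_mem_card_add.2
          ⟨T, mem_sdiff.2 ⟨mem_cubeLayer.2 hT, hTA⟩, hTS, by omega⟩)
  have hdisj : Disjoint (U \ U') (U' \ U) := by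
    rw [disjoint_left]
    intro S h h'
    exact (mem_sdiff.1 h).2 (mem_sdiff.1 h').1
  have hsep : ∀ B ∈ U \ U', ∀ T ∈ U' \ U, r < #(T \ B) := by
    intro B hB T hT
    rw [mem_sdiff] at hB hT
    by_contra! hle
    have hTc : #T = j + r := sized_upShadow_iterate hAs' r hT.1
    have hBc : #B = j + r := sized_upShadow_iterate hAs r hB.1
    have hint : j ≤ #(T ∩ B) := by
      have := card_sdiff_add_card_inter T B
      omega
    obtain ⟨X, hX, hXc⟩ := exists_subset_card_eq hint
    by_cases hXA : X ∈ A
    · exact hT.2 (mem_upShadow_iterate_iff_exists_mem_card_add.2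
        ⟨X, hXA, hX.trans inter_subset_left, by omega⟩)
    · exact hB.2 (mem_upShadow_iterate_iff_exists_mem_card_add.2
        ⟨X, mem_sdiff.2 ⟨mem_cubeLayer.2 hXc, hXA⟩, hX.trans inter_subset_right, by omega⟩)
  have hk : j + r - 1 + 1 = j + r := by omega
  have hmain := card_mul_card_le_of_separated (k := j + r - 1) hr hdisj (by rw [hk, hcov]) hsep
  rw [hk, Fintype.card_fin, Nat.cast_sub (by omega : 1 ≤ j + r)] at hmain
  push_cast at hmain
  rw [sub_add_cancel] at hmain
  have hM : (0 : ℝ) < n.choose (j + r) := by exact_mod_cast Nat.choose_pos hjr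
  have hM0 : (0 : ℝ) < n.choose j := by exact_mod_cast Nat.choose_pos (by omega : j ≤ n)
  have hc : #(U \ U') + #(U' \ U) + #(U ∩ U') = n.choose (j + r) := by
    have h := congrArg card hcov
    rw [card_powersetCard, card_univ, Fintype.card_fin, card_union_of_disjoint,
      card_union_of_disjoint hdisj] at h
    · exact h
    · rw [disjoint_left]
      intro S h h'
      simp only [mem_union, mem_sdiff, mem_inter] at h h'
      tauto
  have hcU : #(U \ U') + #(U ∩ U') = #U := card_sdiff_add_card_inter U U'
  have hcU' : #(U' \ U) + #(U ∩ U') = #U' := by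
    rw [inter_comm]
    exact card_sdiff_add_card_inter U' U
  have h2 := layerMeasure_le_layerMeasure_upShadow_iterate hAs' hjr
  have hcompl : layerMeasure n j A' = 1 - layerMeasure n j A := by
    have : #A' + #A = n.choose j := by
      rw [hA', card_sdiff_add_card_eq_card hA, cubeLayer, card_powersetCard, card_univ,
        Fintype.card_fin]
    rw [layerMeasure, layerMeasure, eq_sub_iff_add_eq, ← add_div, div_eq_one_iff_eq hM0.ne']
    exact_mod_cast this
  rw [hcompl] at h2
  rw [← hU'] at h2
  have hA0 : 0 ≤ layerMeasure n j A := by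
    unfold layerMeasure
    positivity
  have hA1 : 0 ≤ 1 - layerMeasure n j A := by
    rw [← hcompl]
    unfold layerMeasure
    positivity
  set p : ℝ := #(U \ U') / n.choose (j + r) with hp
  set q : ℝ := #(U' \ U) / n.choose (j + r) with hq
  set d : ℝ := layerMeasure n (j + r) (U ∩ U') with hd
  have h1' : layerMeasure n j A ≤ p + d := by
    have : p + d = layerMeasure n (j + r) U := by
      rw [hp, hd, layerMeasure, layerMeasure, ← hcU, ← add_div]
      push_cast
      rfl
    rw [this]
    exact layerMeasure_le_layerMeasure_upShadow_iterate hAs hjr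
  have h2' : 1 - layerMeasure n j A ≤ q + d := by
    have : q + d = layerMeasure n (j + r) U' := by
      rw [hq, hd, layerMeasure, layerMeasure, ← hcU', ← add_div]
      push_cast
      rfl
    rw [this]
    exact h2
  have hsum : p + q + d = 1 := by
    rw [hp, hq, hd, layerMeasure, ← add_div, ← add_div, div_eq_one_iff_eq hM.ne']
    exact_mod_cast hc
  -- Since p + q + d = 1, the product (p + d)(q + d) is exactly pq + d.
  have hprod : layerMeasure n j A * (1 - layerMeasure n j A) ≤ p * q + d := by
    calc _ ≤ (p + d) * (q + d) := mul_le_mul h1' h2' hA1 (hA0.trans h1')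
      _ = p * q + d * (p + q + d) := by ring
      _ = p * q + d := by rw [hsum, mul_one]
  have hpq : (n : ℝ) * r ^ 2 * (p * q) ≤ ((n : ℝ) - (j + r - 1)) * (j + r) * d := by
    have e1 : (#(U \ U') : ℝ) = p * n.choose (j + r) := (div_mul_cancel₀ _ hM.ne').symm
    have e2 : (#(U' \ U) : ℝ) = q * n.choose (j + r) := (div_mul_cancel₀ _ hM.ne').symm
    have e3 : (#(U ∩ U') : ℝ) = d * n.choose (j + r) := (div_mul_cancel₀ _ hM.ne').symm
    rw [e1, e2, e3] at hmain
    refine le_of_mul_le_mul_right ?_ (mul_pos hM hM)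
    linarith
  calc _ ≤ (n : ℝ) * r ^ 2 * (p * q + d) := by gcongr
    _ = n * r ^ 2 * (p * q) + n * r ^ 2 * d := by ring
    _ ≤ _ := by linarith

end Shadow

/-- `Finset.upShadow^[r] A` is the `r`-fold iterated upper shadow of `A`; the complement of `A` is
taken inside the middle layer, and shadows of order `r` live in the layer `n / 2 + r`. -/
theorem theorem1 :
    ∃ C : ℝ, 0 < C ∧ ∃ c : ℝ, 0 < c ∧
      ∀ (ε : ℝ), 0 < ε → ε < 1 →
      ∀ (n : ℕ), Even n →
      ∀ (A : Finset (Finset (Fin n))), A ⊆ cubeLayer n (n / 2) →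
        A ≠ ∅ → A ≠ cubeLayer n (n / 2) →
      ∀ (m : ℝ), m = layerMeasure n (n / 2) A * (1 - layerMeasure n (n / 2) A) →
        C / ε ^ 2 * (Real.log (1 / ε) + Real.log (1 / m)) ≤ (n : ℝ) →
      ∀ (r : ℕ), r = ⌈ε * √(n : ℝ)⌉₊ →
        c * (ε ^ 2 / Real.log (1 / (ε * m))) * m ≤
          layerMeasure n (n / 2 + r)
            (Finset.upShadow^[r] A ∩ Finset.upShadow^[r] (cubeLayer n (n / 2) \ A)) := by
  -- C = 16 forces n ≥ 16, so that r ≤ √n + 1 ≤ n/2 and layer n/2 + r exists; c = 1/2 comes from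
  -- `hfin`.
  refine ⟨16, by norm_num, 1 / 2, by norm_num, ?_⟩
  intro ε hε0 hε1 n hn A hA hne hne' m hm hnC r hr
  obtain ⟨h, rfl⟩ := hn
  have hhalf : (h + h) / 2 = h := by omega
  rw [hhalf] at hA hne' hm ⊢
  have hM0 : (0 : ℝ) < (h + h).choose h := by exact_mod_cast Nat.choose_pos (by omega)
  have hμ0 : 0 < layerMeasure (h + h) h A := by
    have : 0 < #A := card_pos.2 (nonempty_iff_ne_empty.2 hne)
    unfold layerMeasure
    positivity
  have hμ1 : layerMeasure (h + h) h A < 1 := by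
    rw [layerMeasure, div_lt_one hM0]
    have := card_lt_card (hA.ssubset_of_ne hne')
    rw [cubeLayer, card_powersetCard, card_univ, Fintype.card_fin] at this
    exact_mod_cast this
  have hm0 : 0 < m := by
    rw [hm]
    exact mul_pos hμ0 (by linarith)
  have hm4 : m ≤ 1 / 4 := by
    rw [hm]
    nlinarith [sq_nonneg (layerMeasure (h + h) h A - 1 / 2)]
  have hlog4 : ∀ x : ℝ, 0 < x → x ≤ 1 / 4 → 1 ≤ Real.log (1 / x) := by
    intro x hx hx4
    rw [Real.le_log_iff_exp_le (by positivity), le_div_iff₀ hx]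
    nlinarith [Real.exp_one_lt_d9, Real.exp_pos 1]
  -- As εm ≤ 1/4 < 1/e, dividing by this logarithm only weakens the bound.
  have hL : 1 ≤ Real.log (1 / (ε * m)) :=
    hlog4 _ (by positivity) (by nlinarith)
  have hn16 : (16 : ℝ) ≤ (h + h : ℕ) := by
    refine le_trans ?_ hnC
    have h1 : 0 ≤ Real.log (1 / ε) := Real.log_nonneg (by rw [le_div_iff₀ hε0]; linarith)
    have h2 := hlog4 m hm0 hm4
    have h3 : (16 : ℝ) ≤ 16 / ε ^ 2 := by
      rw [le_div_iff₀ (by positivity)]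
      nlinarith
    nlinarith
  set N : ℝ := ((h + h : ℕ) : ℝ) with hN
  have hNh : N = 2 * h := by rw [hN]; push_cast; ring
  have hsq : √N ^ 2 = N := Real.sq_sqrt (by linarith)
  have hs4 : 4 ≤ √N := Real.le_sqrt_of_sq_le (by linarith)
  have hr1 : 1 ≤ r := by
    rw [hr, Nat.one_le_ceil_iff]
    positivity
  have hrlow : ε * √N ≤ r := hr ▸ Nat.le_ceil _
  have hrh : h + r ≤ h + h := by
    have h1 : (r : ℝ) < ε * √N + 1 := hr ▸ Nat.ceil_lt_add_one (by positivity)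
    have h2 : (r : ℝ) ≤ h := by nlinarith
    have : r ≤ h := by exact_mod_cast h2
    omega
  have key := layerMeasure_upShadow_inter_lower_bound hr1 hrh hA
  rw [← hm, ← hN] at key
  set d := layerMeasure (h + h) (h + r)
    (Finset.upShadow^[r] A ∩ Finset.upShadow^[r] (cubeLayer (h + h) h \ A))
  have hd0 : 0 ≤ d := by
    simp only [d, layerMeasure]
    positivity
  have hr2 : ε ^ 2 * N ≤ (r : ℝ) ^ 2 := by
    calc ε ^ 2 * N = (ε * √N) ^ 2 := by rw [mul_pow, hsq]
      _ ≤ (r : ℝ) ^ 2 := by gcongr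
  have hr1' : (1 : ℝ) ≤ r := by exact_mod_cast hr1
  -- The factors are h + 1 - r ≤ h and h + r ≤ 2h.
  have hdeg : (N - (h + r - 1)) * (h + r) ≤ N ^ 2 / 2 := by
    rw [hNh] at hn16 ⊢
    nlinarith
  have hfin : ε ^ 2 * m ≤ 2 * d := by
    have hpos : 0 < N * (r : ℝ) ^ 2 := by positivity
    refine le_of_mul_le_mul_left ?_ hpos
    calc N * (r : ℝ) ^ 2 * (ε ^ 2 * m) = ε ^ 2 * (N * (r : ℝ) ^ 2 * m) := by ring
      _ ≤ ε ^ 2 * ((N * r ^ 2 + N ^ 2 / 2) * d) := by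
          refine mul_le_mul_of_nonneg_left (key.trans ?_) (sq_nonneg ε)
          gcongr
      _ = (ε ^ 2 * (N * r ^ 2) + N * (ε ^ 2 * N) / 2) * d := by ring
      -- The first term uses ε² ≤ 1, the second ε²N ≤ r².
      _ ≤ (1 * (N * r ^ 2) + N * r ^ 2 / 2) * d := by
          gcongr
          nlinarith
      _ ≤ N * r ^ 2 * (2 * d) := by nlinarith [mul_nonneg hpos.le hd0]
  have hdiv : ε ^ 2 / Real.log (1 / (ε * m)) ≤ ε ^ 2 := div_le_self (by positivity) hL
  calc 1 / 2 * (ε ^ 2 / Real.log (1 / (ε * m))) * m ≤ 1 / 2 * ε ^ 2 * m := by gcongr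
    _ ≤ d := by linarith
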